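/- Let $K$ be a field of characteristic $0$ and let $A_1$ be the first Weyl algebra over $K$, i.e. the associative unital $K$-algebra generated by $p,q$ subject to the relation $pq-qp=1$. For $t\in\mathbb{Z}$ let $D_t$ be the $K$-linear span of all $p^iq^j$ with $i,j\ge 0$ and $j-i=t$, so that $A_1=\bigoplus_{t\in\mathbb{Z}}D_t$, and let $D_{>t}=\bigoplus_{r>t}D_r$. For $x\in A_1$ let $C(x)=\{y\in A_1 : xy=yx\}$ be its centralizer and $K[x]=\{f(x) : f\in K[X]\}$. Let $z,w\in A_1$ satisfy $[z,w]=zw-wz=1$. Suppose that $z=z_{-s}+z'$ for some integer $s>0$, some nonzero $z_{-s}\in D_{-s}$ and some $z'\in D_{>-s}$, and that $C(z_{-s})=K[z_{-s}]$. Then $z$ and $w$ generate $A_1$ as a $K$-algebra. -/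

import Mathlib

/-- The defining relation `p q = q p + 1` on the free algebra on two letters;
the letter `0` stands for `p` and the letter `1` for `q`. -/
inductive FirstWeylRel (K : Type*) [CommRing K] :
    FreeAlgebra K (Fin 2) → FreeAlgebra K (Fin 2) → Prop
  | comm : FirstWeylRel K
      (FreeAlgebra.ι K (0 : Fin 2) * FreeAlgebra.ι K (1 : Fin 2))
      (FreeAlgebra.ι K (1 : Fin 2) * FreeAlgebra.ι K (0 : Fin 2) + 1)

/-- The first Weyl algebra `A₁` over `K`: the associative unital `K`-algebra generated by
`p` and `q` subject to the single relation `p q - q p = 1`. -/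
abbrev FirstWeylAlgebra (K : Type*) [CommRing K] : Type _ :=
  RingQuot (FirstWeylRel K)

namespace FirstWeylAlgebra

/-- The generator `p`. -/
def p (K : Type*) [CommRing K] : FirstWeylAlgebra K :=
  RingQuot.mkAlgHom K (FirstWeylRel K) (FreeAlgebra.ι K (0 : Fin 2))

/-- The generator `q`. -/
def q (K : Type*) [CommRing K] : FirstWeylAlgebra K :=
  RingQuot.mkAlgHom K (FirstWeylRel K) (FreeAlgebra.ι K (1 : Fin 2))

/-- The homogeneous component `D_t`, the span of all `p ^ i * q ^ j` with `j - i = t`. -/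
def homogeneous (K : Type*) [CommRing K] (t : ℤ) : Submodule K (FirstWeylAlgebra K) :=
  Submodule.span K {x | ∃ i j : ℕ, (j : ℤ) - (i : ℤ) = t ∧ x = p K ^ i * q K ^ j}

/-- `D_{> i}`, the sum of all `D_t` with `t > i`. -/
def homogeneousGT (K : Type*) [CommRing K] (i : ℤ) : Submodule K (FirstWeylAlgebra K) :=
  ⨆ t : ℤ, ⨆ _ : i < t, homogeneous K t

end FirstWeylAlgebra

open Polynomial

/-! ### Leading coefficients of shift commutators -/

namespace Polynomial

variable {K : Type*} [Field K]

/-! Put `n = pq`. The Weyl algebra embeds in the skew Laurent polynomials by `p ↦ n x⁻¹`, `q ↦ x`,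
the exponent of `x` giving the grading. A commutator of `f(n) x^a` and `g(n) x^b` behaves like a
Poisson bracket: with `d = deg f` and `e = deg g`, its coefficient in degree `d + e - 1` is `db -
ea` times the two leading coefficients (`coeff_shiftComm`).

If the lowest component of `w` has degree `r < s`, it commutes with that of `z`, because `[z, w] =
1` has no component in degree `r - s < 0`. By the centralizer hypothesis it is a multiple of a power
of `z_{-s}`, and subtracting the same multiple of that power of `z` raises the order of `w` while
keeping the commutator and the generated algebra. Hence `w` may be assumed to start in degree `s`.

The lowest components then have commutator `1`. Comparing degrees, and using that a nonzero
coefficient of `x^(-s)` has degree at least `s` on the Weyl algebra, forces `s = 1` and the degrees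
of `p` and `q` (`lowest_of_commutator_eq_one`). A Newton polygon argument (`eq_of_slope_bound`,
`triangular_of_commutator_eq_one`) then shows that `w` is a scalar multiple of `q` and `z` is a
scalar multiple of `p` plus a polynomial in `q`, so both generators are recovered. -/

theorem coeff_sub_taylor_of_natDegree_le (c : K) {f : K[X]} {d k : ℕ} (hf : f.natDegree ≤ d)
    (hk : d ≤ k + 1) :
    (f - taylor (-c) f).coeff k = if d = k + 1 then (d : K) * c * f.coeff d else 0 := by
  -- By linearity monomials suffice; for them the binomial expansion leaves one term in the range `n
  -- ≤ k + 1`.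
  have key : ∀ n, n ≤ d → (X ^ n - taylor (-c) (X ^ n) : K[X]).coeff k
      = if n = k + 1 then (n : K) * c else 0 := by
    intro n hn
    rw [taylor_X_pow, coeff_sub, coeff_X_add_C_pow, coeff_X_pow]
    rcases lt_trichotomy n k with h | rfl | h
    · simp [Nat.choose_eq_zero_of_lt h, h.ne', (show n ≠ k + 1 by omega)]
    · simp
    · obtain rfl : n = k + 1 := by omega
      simp [mul_comm]
  have hs : f = ∑ n ∈ Finset.range (d + 1), C (f.coeff n) * X ^ n :=
    f.as_sum_range_C_mul_X_pow' (by omega)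
  have h1 : f - taylor (-c) f
      = ∑ n ∈ Finset.range (d + 1), C (f.coeff n) * (X ^ n - taylor (-c) (X ^ n)) := by
    conv_lhs => rw [hs]
    rw [map_sum, ← Finset.sum_sub_distrib]
    refine Finset.sum_congr rfl fun n _ => ?_
    rw [taylor_mul, taylor_C, mul_sub]
  rw [h1, finsetSum_coeff, Finset.sum_eq_single d]
  · rw [coeff_C_mul, key d le_rfl]
    split_ifs <;> ring
  · intro n hn hnd
    rw [Finset.mem_range] at hn
    rw [coeff_C_mul, key n (by omega), if_neg (by omega), mul_zero]
  · simp

/-- The coefficient polynomial of the commutator of `f x ^ a` and `g x ^ b`, where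
`x g(n) = g(n - 1) x`. -/
noncomputable def shiftComm (f g : K[X]) (a b : ℤ) : K[X] :=
  f * taylor (-(a : K)) g - g * taylor (-(b : K)) f

theorem shiftComm_eq (f g : K[X]) (a b : ℤ) :
    shiftComm f g a b = g * (f - taylor (-(b : K)) f) - f * (g - taylor (-(a : K)) g) := by
  unfold shiftComm
  ring

/-- A finite difference lowers the degree by one, so the product has degree at most `d + e - 1`.
Writing this as `d + e ≤ k + 1` avoids truncated subtraction when `d = e = 0`. -/
theorem coeff_mul_sub_taylor (c : K) {f g : K[X]} {d e k : ℕ} (hf : f.natDegree ≤ d)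
    (hg : g.natDegree ≤ e) (hk : d + e ≤ k + 1) :
    (g * (f - taylor (-c) f)).coeff k
      = if d + e = k + 1 then (d : K) * c * f.coeff d * g.coeff e else 0 := by
  rcases d with _ | d
  · obtain ⟨r, rfl⟩ : ∃ r, f = C r := ⟨_, eq_C_of_natDegree_le_zero hf⟩
    simp
  have hD : (f - taylor (-c) f).natDegree ≤ d := by
    refine natDegree_le_iff_coeff_eq_zero.2 fun n hn => ?_
    rw [coeff_sub_taylor_of_natDegree_le c hf (by omega), if_neg (by omega)]
  by_cases h : d + 1 + e = k + 1
  · obtain rfl : k = e + d := by omega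
    rw [if_pos h, coeff_mul_add_eq_of_natDegree_le hg hD,
      coeff_sub_taylor_of_natDegree_le c hf le_rfl, if_pos rfl, mul_comm]
  · rw [if_neg h]
    refine coeff_eq_zero_of_natDegree_lt (lt_of_le_of_lt natDegree_mul_le ?_)
    omega

/-- The top terms `fg` cancel and the next ones combine into the determinant of `(d, a)` and `(e,
b)`. All degree arguments below rest on its being nonzero. -/
theorem coeff_shiftComm {f g : K[X]} (a b : ℤ) {d e k : ℕ} (hf : f.natDegree ≤ d)
    (hg : g.natDegree ≤ e) (hk : d + e ≤ k + 1) :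
    (shiftComm f g a b).coeff k
      = if d + e = k + 1 then ((d : K) * b - e * a) * f.coeff d * g.coeff e else 0 := by
  rw [shiftComm_eq, coeff_sub, coeff_mul_sub_taylor _ hf hg hk,
    coeff_mul_sub_taylor _ hg hf (by omega), add_comm e d]
  split_ifs <;> ring

@[simp] theorem shiftComm_zero_left (g : K[X]) (a b : ℤ) : shiftComm 0 g a b = 0 := by
  simp [shiftComm]

@[simp] theorem shiftComm_zero_right (f : K[X]) (a b : ℤ) : shiftComm f 0 a b = 0 := by
  simp [shiftComm]

/-- Translation of polynomials by integers. -/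
noncomputable instance shiftAction : MulSemiringAction (Multiplicative ℤ) K[X] where
  smul a f := taylor (-(a.toAdd : K)) f
  one_smul f := by
    change taylor (-((0 : ℤ) : K)) f = f
    simp
  mul_smul a b f := by
    change taylor (-((a.toAdd + b.toAdd : ℤ) : K)) f = taylor _ (taylor _ f)
    rw [taylor_taylor]
    push_cast
    ring_nf
  smul_zero _ := map_zero _
  smul_add _ := map_add _
  smul_one _ := by
    change taylor _ 1 = 1
    simp
  smul_mul _ := taylor_mul _

theorem shift_smul_def (a : Multiplicative ℤ) (f : K[X]) :
    a • f = taylor (-(a.toAdd : K)) f := rfl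

instance shiftAction_smulCommClass : SMulCommClass (Multiplicative ℤ) K K[X] where
  smul_comm a c f := by
    rw [shift_smul_def, shift_smul_def, map_smul]

end Polynomial

/-- The skew Laurent polynomials `∑ f_t(n) x ^ t` with `x f(n) = f(n - 1) x`. -/
abbrev ShiftLaurent (K : Type*) [Field K] : Type _ :=
  SkewMonoidAlgebra K[X] (Multiplicative ℤ)

/-! ### Skew Laurent polynomials and their lowest components -/

namespace ShiftLaurent

open SkewMonoidAlgebra (single single_mul_single smul_single)
open Multiplicative

variable {K : Type*} [Field K]

/-- The coefficient of `x ^ t`. -/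
noncomputable def cf (t : ℤ) : ShiftLaurent K →ₗ[K] K[X] where
  toFun x := x.coeff (ofAdd t)
  map_add' _ _ := by simp
  map_smul' _ _ := by simp

/-- The monomial `f x ^ t`. -/
noncomputable def mono (t : ℤ) (f : K[X]) : ShiftLaurent K := single (ofAdd t) f

theorem ext_cf {x y : ShiftLaurent K} (h : ∀ t, cf t x = cf t y) : x = y :=
  SkewMonoidAlgebra.ext fun a => h a.toAdd

theorem cf_mono (t r : ℤ) (f : K[X]) : cf r (mono t f) = if t = r then f else 0 := by
  classical
  change (Finsupp.single (ofAdd t) f) (ofAdd r) = _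
  rw [Finsupp.single_apply]
  simp

@[simp] theorem cf_mono_self (t : ℤ) (f : K[X]) : cf t (mono t f) = f := by
  rw [cf_mono, if_pos rfl]

theorem mono_mul_mono (a b : ℤ) (f g : K[X]) :
    mono a f * mono b g = mono (a + b) (f * taylor (-(a : K)) g) := by
  unfold mono
  rw [single_mul_single, shift_smul_def]
  rfl

theorem one_eq_mono : (1 : ShiftLaurent K) = mono 0 1 := rfl

theorem smul_mono (c : K) (t : ℤ) (f : K[X]) : c • mono t f = mono t (c • f) :=
  smul_single _ _ _

/-- The exponents of `x` that occur. -/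
noncomputable def supp (x : ShiftLaurent K) : Finset ℤ :=
  x.support.map Multiplicative.toAdd.toEmbedding

theorem mem_supp {x : ShiftLaurent K} {t : ℤ} : t ∈ supp x ↔ cf t x ≠ 0 := by
  simp only [supp, Finset.mem_map, SkewMonoidAlgebra.mem_support_iff]
  constructor
  · rintro ⟨a, ha, rfl⟩
    exact ha
  · intro h
    exact ⟨ofAdd t, h, rfl⟩

theorem eq_sum_mono (x : ShiftLaurent K) : x = ∑ t ∈ supp x, mono t (cf t x) := by
  refine ext_cf fun r => ?_
  rw [map_sum]
  simp only [cf_mono, Finset.sum_ite_eq']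
  split_ifs with h
  · rfl
  · exact not_not.1 (mt mem_supp.2 h)

theorem cf_mul (x y : ShiftLaurent K) (r : ℤ) :
    cf r (x * y) = ∑ a ∈ supp x, ∑ b ∈ supp y,
      if a + b = r then cf a x * taylor (-(a : K)) (cf b y) else 0 := by
  conv_lhs => rw [eq_sum_mono x, eq_sum_mono y]
  simp only [Finset.sum_mul, Finset.mul_sum, map_sum, mono_mul_mono, cf_mono]
  rw [Finset.sum_comm]

theorem cf_commutator (x y : ShiftLaurent K) (r : ℤ) :
    cf r (x * y - y * x) = ∑ a ∈ supp x, ∑ b ∈ supp y,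
      if a + b = r then shiftComm (cf a x) (cf b y) a b else 0 := by
  rw [map_sub, cf_mul, cf_mul, Finset.sum_comm (s := supp y), ← Finset.sum_sub_distrib]
  refine Finset.sum_congr rfl fun a _ => ?_
  rw [← Finset.sum_sub_distrib]
  refine Finset.sum_congr rfl fun b _ => ?_
  rw [add_comm b a, shiftComm]
  split_ifs <;> simp

/-- All exponents are at least `a`. -/
def LowerBound (a : ℤ) (x : ShiftLaurent K) : Prop := ∀ t < a, cf t x = 0

theorem LowerBound.le_of_mem {a : ℤ} {x : ShiftLaurent K} (h : LowerBound a x) {t : ℤ}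
    (ht : t ∈ supp x) : a ≤ t :=
  not_lt.1 fun hlt => mem_supp.1 ht (h t hlt)

theorem LowerBound.mul {a b : ℤ} {x y : ShiftLaurent K} (hx : LowerBound a x)
    (hy : LowerBound b y) : LowerBound (a + b) (x * y) := by
  intro r hr
  rw [cf_mul]
  refine Finset.sum_eq_zero fun i hi => Finset.sum_eq_zero fun j hj => if_neg ?_
  have := hx.le_of_mem hi
  have := hy.le_of_mem hj
  omega

theorem LowerBound.cf_mul {a b : ℤ} {x y : ShiftLaurent K} (hx : LowerBound a x)
    (hy : LowerBound b y) : cf (a + b) (x * y) = cf a x * taylor (-(a : K)) (cf b y) := by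
  rw [ShiftLaurent.cf_mul, Finset.sum_eq_single a]
  · rw [Finset.sum_eq_single b]
    · rw [if_pos rfl]
    · intro j _ hjb
      exact if_neg (by omega)
    · intro hb
      rw [if_pos rfl, not_not.1 (mt mem_supp.2 hb)]
      simp
  · intro i hi hia
    refine Finset.sum_eq_zero fun j hj => if_neg ?_
    have := hx.le_of_mem hi
    have := hy.le_of_mem hj
    omega
  · intro ha
    refine Finset.sum_eq_zero fun j _ => ?_
    rw [not_not.1 (mt mem_supp.2 ha)]
    simp

theorem LowerBound.pow {a : ℤ} {x : ShiftLaurent K} (hx : LowerBound a x) (k : ℕ) :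
    LowerBound (k * a) (x ^ k) := by
  induction k with
  | zero =>
    intro t ht
    rw [pow_zero, one_eq_mono, cf_mono, if_neg]
    simp at ht
    omega
  | succ k ih =>
    have := ih.mul hx
    rwa [← pow_succ, show (k : ℤ) * a + a = ((k + 1 : ℕ) : ℤ) * a by push_cast; ring] at this

/-- Lowest components multiply, so those of powers depend only on the lowest component of the base.
This lets `z ^ k` replace the power of its lowest component. -/
theorem LowerBound.cf_pow_congr {a : ℤ} {x y : ShiftLaurent K} (hx : LowerBound a x)
    (hy : LowerBound a y) (h : cf a x = cf a y) (k : ℕ) :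
    cf (k * a) (x ^ k) = cf (k * a) (y ^ k) := by
  induction k with
  | zero => simp
  | succ k ih =>
    rw [show ((k + 1 : ℕ) : ℤ) * a = (k : ℤ) * a + a by push_cast; ring, pow_succ, pow_succ,
      (hx.pow k).cf_mul hx, (hy.pow k).cf_mul hy, ih, h]

theorem LowerBound.cf_commutator {a b : ℤ} {x y : ShiftLaurent K} (hx : LowerBound a x)
    (hy : LowerBound b y) :
    cf (a + b) (x * y - y * x) = shiftComm (cf a x) (cf b y) a b := by
  rw [map_sub, hx.cf_mul hy, add_comm a b, hy.cf_mul hx, shiftComm]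

theorem mono_pow (t : ℤ) (f : K[X]) (k : ℕ) : ∃ g, mono t f ^ k = mono (k * t) g := by
  induction k with
  | zero => exact ⟨1, by simp [one_eq_mono]⟩
  | succ k ih =>
    obtain ⟨g, hg⟩ := ih
    refine ⟨g * taylor (-((k * t : ℤ) : K)) f, ?_⟩
    rw [pow_succ, hg, mono_mul_mono]
    congr 1
    push_cast
    ring

theorem coeff_cf_one {r : ℤ} {k : ℕ} (h : (cf r (1 : ShiftLaurent K)).coeff k ≠ 0) :
    r = 0 ∧ k = 0 := by
  rw [one_eq_mono, cf_mono] at h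
  split_ifs at h with h0
  · refine ⟨h0.symm, ?_⟩
    by_contra hk
    exact h (by rw [coeff_one, if_neg hk])
  · simp at h

/-! ### Newton polygon argument -/

/-- Leading terms with respect to the slope `κ`: if `[x, y] = 1` and the degrees satisfy linear
bounds, then the bounds are attained only at the exponents `-1` of `x` and `1` of `y`. -/
theorem eq_of_slope_bound [CharZero K] {x y : ShiftLaurent K} (hxy : x * y - y * x = 1)
    (hx : LowerBound (-1) x) (hy : LowerBound 1 y) {κ : ℚ} (hκ : 0 ≤ κ)
    (hdx : ∀ t ∈ supp x, ((cf t x).natDegree : ℚ) ≤ 1 + κ * (t + 1))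
    (hdy : ∀ t ∈ supp y, ((cf t y).natDegree : ℚ) ≤ κ * (t - 1))
    (hx0 : ∃ t ∈ supp x, ((cf t x).natDegree : ℚ) = 1 + κ * (t + 1))
    (hy0 : ∃ t ∈ supp y, ((cf t y).natDegree : ℚ) = κ * (t - 1)) :
    (∀ t ∈ supp x, ((cf t x).natDegree : ℚ) = 1 + κ * (t + 1) → t = -1) ∧
    (∀ t ∈ supp y, ((cf t y).natDegree : ℚ) = κ * (t - 1) → t = 1) := by
  classical
  -- Among the points on the two bounding lines, those with the largest exponents are chosen, so
  -- that their leading term in the commutator cannot cancel.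
  obtain ⟨a, haS, hamax⟩ := ((supp x).filter fun t =>
    ((cf t x).natDegree : ℚ) = 1 + κ * (t + 1)).exists_max_image id
      (by obtain ⟨t, h1, h2⟩ := hx0; exact ⟨t, Finset.mem_filter.2 ⟨h1, h2⟩⟩)
  obtain ⟨b, hbS, hbmax⟩ := ((supp y).filter fun t =>
    ((cf t y).natDegree : ℚ) = κ * (t - 1)).exists_max_image id
      (by obtain ⟨t, h1, h2⟩ := hy0; exact ⟨t, Finset.mem_filter.2 ⟨h1, h2⟩⟩)
  rw [Finset.mem_filter] at haS hbS
  obtain ⟨ha, had⟩ := haS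
  obtain ⟨hb, hbd⟩ := hbS
  have ha1 := hx.le_of_mem ha
  have hb1 := hy.le_of_mem hb
  have ha1' : (-1 : ℚ) ≤ a := by exact_mod_cast ha1
  have hb1' : (1 : ℚ) ≤ b := by exact_mod_cast hb1
  set d := (cf a x).natDegree with hd
  set e := (cf b y).natDegree with he
  have hd1 : 1 ≤ d := by
    have : (1 : ℚ) ≤ d := by
      rw [had]
      have := mul_nonneg hκ (by linarith : (0 : ℚ) ≤ a + 1)
      linarith
    exact_mod_cast this
  -- On the bounding lines the determinant equals `b + κ(a + b)`, which is positive since `b ≥ 1`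
  -- and `a + b ≥ 0`.
  have hdet : ((d : K) * b - e * a) ≠ 0 := by
    have h1 : (0 : ℚ) < (d : ℚ) * b - e * a := by
      rw [had, hbd]
      have := mul_nonneg hκ (by linarith : (0 : ℚ) ≤ a + b)
      nlinarith
    have h2 : (((d : ℚ) * b - e * a : ℚ) : K) ≠ 0 := by exact_mod_cast h1.ne'
    push_cast at h2
    exact h2
  have hcoeff : (cf (a + b) (x * y - y * x)).coeff (d + e - 1)
      = ((d : K) * b - e * a) * (cf a x).coeff d * (cf b y).coeff e := by
    rw [cf_commutator, finsetSum_coeff, Finset.sum_eq_single a]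
    · rw [finsetSum_coeff, Finset.sum_eq_single b]
      · rw [if_pos rfl, coeff_shiftComm a b le_rfl le_rfl (by omega), if_pos (by omega)]
      · intro j _ hjb
        rw [if_neg (by omega), coeff_zero]
      · exact fun h => absurd hb h
    · intro i hi hia
      rw [finsetSum_coeff]
      refine Finset.sum_eq_zero fun j hj => ?_
      split_ifs with hij
      · have hlt : (cf i x).natDegree + (cf j y).natDegree < d + e := by
          have h1 := hdx i hi
          have h2 := hdy j hj
          have hsum : (i : ℚ) + j = a + b := by exact_mod_cast hij
          have hde : (d : ℚ) + e = 1 + κ * (i + 1) + κ * (j - 1) := by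
            rw [had, hbd]
            linear_combination (-κ) * hsum
          -- Equality would put both points on their lines, so `i ≤ a` and `j ≤ b` by maximality;
          -- with `i + j = a + b` this gives `i = a`.
          have hq : ((cf i x).natDegree : ℚ) + (cf j y).natDegree < d + e := by
            by_contra hge
            have e1 : ((cf i x).natDegree : ℚ) = 1 + κ * (i + 1) := by linarith
            have e2 : ((cf j y).natDegree : ℚ) = κ * (j - 1) := by linarith
            have m1 := hamax i (Finset.mem_filter.2 ⟨hi, e1⟩)
            have m2 := hbmax j (Finset.mem_filter.2 ⟨hj, e2⟩)
            simp only [id] at m1 m2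
            omega
          exact_mod_cast hq
        rw [coeff_shiftComm i j le_rfl le_rfl (by omega), if_neg (by omega)]
      · simp
    · exact fun h => absurd ha h
  have hne : (cf (a + b) (1 : ShiftLaurent K)).coeff (d + e - 1) ≠ 0 := by
    rw [← hxy, hcoeff]
    refine mul_ne_zero (mul_ne_zero hdet ?_) ?_
    · exact leadingCoeff_ne_zero.2 (mem_supp.1 ha)
    · exact leadingCoeff_ne_zero.2 (mem_supp.1 hb)
  -- The commutator is `1`, so the surviving term sits at `a + b = 0`; with `a ≥ -1` and `b ≥ 1`
  -- this leaves only `a = -1`, `b = 1`.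
  obtain ⟨h0, -⟩ := coeff_cf_one hne
  constructor
  · intro t ht htd
    have h1 := hamax t (Finset.mem_filter.2 ⟨ht, htd⟩)
    have h2 := hx.le_of_mem ht
    simp only [id] at h1
    omega
  · intro t ht htd
    have h1 := hbmax t (Finset.mem_filter.2 ⟨ht, htd⟩)
    have h2 := hy.le_of_mem ht
    simp only [id] at h1
    omega

/-- If `[x, y] = 1`, where `x` starts in exponent `-1` and `y` in exponent `1` with the degrees of
`p` and `q`, then `y` is a multiple of `q` and the higher coefficients of `x` are constant. -/
theorem triangular_of_commutator_eq_one [CharZero K] {x y : ShiftLaurent K}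
    (hxy : x * y - y * x = 1) (hx : LowerBound (-1) x) (hy : LowerBound 1 y)
    (hdx : (cf (-1) x).natDegree = 1) (hy0 : cf 1 y ≠ 0) (hdy : (cf 1 y).natDegree = 0) :
    (∀ t ≠ -1, (cf t x).natDegree = 0) ∧ (∀ t ≠ 1, cf t y = 0) := by
  classical
  have hx0 : cf (-1) x ≠ 0 := by
    intro h
    simp [h] at hdx
  -- These are the slopes from the base point `(-1, 1)` to the other points of `x` and from `(1, 0)`
  -- to those of `y`. Their maximum is the smallest admissible `κ`; inserting `0` ensures `κ ≥ 0`.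
  set S : Finset ℚ := insert 0
    (((supp x).erase (-1)).image (fun t => (((cf t x).natDegree : ℚ) - 1) / (t + 1)) ∪
      ((supp y).erase 1).image (fun t => ((cf t y).natDegree : ℚ) / (t - 1))) with hS
  have hSne : S.Nonempty := Finset.insert_nonempty _ _
  obtain ⟨κ, hκS, hκmax⟩ := S.exists_max_image id hSne
  simp only [id] at hκmax
  have hκ0 : 0 ≤ κ := hκmax 0 (Finset.mem_insert_self _ _)
  have hposx : ∀ t ∈ supp x, t ≠ -1 → (0 : ℚ) < t + 1 := by
    intro t ht hne
    have := hx.le_of_mem ht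
    have : (0 : ℤ) < t + 1 := by omega
    exact_mod_cast this
  have hposy : ∀ t ∈ supp y, t ≠ 1 → (0 : ℚ) < t - 1 := by
    intro t ht hne
    have := hy.le_of_mem ht
    have : (0 : ℤ) < t - 1 := by omega
    exact_mod_cast this
  have hbx : ∀ t ∈ supp x, ((cf t x).natDegree : ℚ) ≤ 1 + κ * (t + 1) := by
    intro t ht
    by_cases hne : t = -1
    · subst hne
      simp [hdx]
    · have := hκmax _ (Finset.mem_insert_of_mem (Finset.mem_union_left _
        (Finset.mem_image_of_mem _ (Finset.mem_erase.2 ⟨hne, ht⟩))))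
      rw [div_le_iff₀ (hposx t ht hne)] at this
      linarith
  have hby : ∀ t ∈ supp y, ((cf t y).natDegree : ℚ) ≤ κ * (t - 1) := by
    intro t ht
    by_cases hne : t = 1
    · subst hne
      simp [hdy]
    · have := hκmax _ (Finset.mem_insert_of_mem (Finset.mem_union_right _
        (Finset.mem_image_of_mem _ (Finset.mem_erase.2 ⟨hne, ht⟩))))
      rwa [div_le_iff₀ (hposy t ht hne)] at this
  obtain ⟨hX, hY⟩ := eq_of_slope_bound hxy hx hy hκ0 hbx hby
    ⟨-1, mem_supp.2 hx0, by simp [hdx]⟩ ⟨1, mem_supp.2 hy0, by simp [hdy]⟩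
  -- If the maximum came from a point other than the base points, that point would lie on its
  -- bounding line, which has just been excluded.
  have hκ : κ = 0 := by
    rw [hS, Finset.mem_insert, Finset.mem_union, Finset.mem_image, Finset.mem_image] at hκS
    rcases hκS with h | ⟨t, ht, h⟩ | ⟨t, ht, h⟩
    · exact h
    · rw [Finset.mem_erase] at ht
      rw [div_eq_iff (hposx t ht.2 ht.1).ne'] at h
      exact absurd (hX t ht.2 (by linarith)) ht.1
    · rw [Finset.mem_erase] at ht
      rw [div_eq_iff (hposy t ht.2 ht.1).ne'] at h
      exact absurd (hY t ht.2 h) ht.1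
  subst hκ
  constructor
  · intro t hne
    by_cases ht : t ∈ supp x
    · have h1 := hbx t ht
      have h2 : ((cf t x).natDegree : ℚ) ≠ 1 := fun h => hne (hX t ht (by linarith))
      have h3 : (cf t x).natDegree ≤ 1 := by
        have : ((cf t x).natDegree : ℚ) ≤ 1 := by linarith
        exact_mod_cast this
      have h4 : (cf t x).natDegree ≠ 1 := by exact_mod_cast h2
      omega
    · rw [mem_supp, not_not] at ht
      simp [ht]
  · intro t hne
    by_contra ht
    have ht := mem_supp.2 ht
    have h1 := hby t ht
    refine hne (hY t ht (le_antisymm h1 ?_))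
    simp

end ShiftLaurent

/-! ### Embedding the Weyl algebra and its normal form -/

namespace FirstWeylAlgebra

open ShiftLaurent

variable {K : Type*} [Field K]

theorem p_mul_q : p K * q K = q K * p K + 1 := by
  have := RingQuot.mkAlgHom_rel K (FirstWeylRel.comm (K := K))
  simpa [p, q] using this

theorem adjoin_p_q : Algebra.adjoin K {p K, q K} = ⊤ := by
  rw [← (RingQuot.mkAlgHom K (FirstWeylRel K)).range_eq_top.2 (RingQuot.mkAlgHom_surjective K _),
    ← Algebra.map_top, ← FreeAlgebra.adjoin_range_ι, AlgHom.map_adjoin, ← Set.range_comp]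
  congr 1
  ext x
  simp [Fin.exists_fin_two, p, q, eq_comm]

theorem mono_relation :
    (mono (-1) X * mono 1 1 : ShiftLaurent K) = mono 1 1 * mono (-1) X + 1 := by
  refine ext_cf fun r => ?_
  rw [map_add, mono_mul_mono, mono_mul_mono, one_eq_mono]
  simp only [cf_mono]
  norm_num
  split_ifs <;> simp

/-- The embedding of the Weyl algebra into the skew Laurent polynomials, `p ↦ n x⁻¹`, `q ↦ x`. -/
noncomputable def symbol (K : Type*) [Field K] : FirstWeylAlgebra K →ₐ[K] ShiftLaurent K :=
  RingQuot.liftAlgHom K ⟨FreeAlgebra.lift K ![mono (-1) X, mono 1 1], by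
    rintro _ _ ⟨⟩
    simpa using mono_relation⟩

@[simp] theorem symbol_p : symbol K (p K) = mono (-1) X := by
  simp [symbol, p]

@[simp] theorem symbol_q : symbol K (q K) = mono 1 1 := by
  simp [symbol, q]

theorem symbol_q_pow (n : ℕ) : symbol K (q K ^ n) = mono n 1 := by
  induction n with
  | zero => simp [one_eq_mono]
  | succ n ih =>
    rw [pow_succ, map_mul, ih, symbol_q, mono_mul_mono, taylor_one]
    simp

/-- The polynomial is the rising factorial `X(X + 1)⋯(X + n - 1)`. -/
theorem symbol_p_pow (n : ℕ) :
    ∃ g : K[X], g ≠ 0 ∧ g.natDegree = n ∧ symbol K (p K ^ n) = mono (-n) g := by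
  induction n with
  | zero => exact ⟨1, one_ne_zero, natDegree_one, by simp [one_eq_mono]⟩
  | succ n ih =>
    obtain ⟨g, hg0, hgn, hg⟩ := ih
    have h0 : taylor (-((-1 : ℤ) : K)) g ≠ 0 := by rwa [Ne, taylor_eq_zero]
    refine ⟨X * taylor (-((-1 : ℤ) : K)) g, mul_ne_zero X_ne_zero h0, ?_, ?_⟩
    · rw [natDegree_mul X_ne_zero h0, natDegree_taylor, natDegree_X, hgn, add_comm]
    · rw [pow_succ', map_mul, hg, symbol_p, mono_mul_mono]
      congr 1
      push_cast
      ring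

/-- `p ^ (-t)` or `q ^ t`, according to the sign of `t`. -/
noncomputable def gen (K : Type*) [Field K] (t : ℤ) : FirstWeylAlgebra K :=
  if 0 ≤ t then q K ^ t.toNat else p K ^ (-t).toNat

theorem gen_natCast (n : ℕ) : gen K n = q K ^ n := by
  simp [gen]

theorem gen_neg_natCast (n : ℕ) : gen K (-n) = p K ^ n := by
  rcases n with _ | n
  · simp [gen]
  · rw [gen, if_neg (by push_cast; omega), neg_neg, Int.toNat_natCast]

theorem symbol_gen (t : ℤ) :
    ∃ g : K[X], g ≠ 0 ∧ g.natDegree = (-t).toNat ∧ symbol K (gen K t) = mono t g := by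
  rcases le_total 0 t with h | h
  · lift t to ℕ using h
    refine ⟨1, one_ne_zero, by simp, ?_⟩
    rw [gen_natCast, symbol_q_pow]
  · obtain ⟨n, rfl⟩ : ∃ n : ℕ, t = -n := ⟨(-t).toNat, by omega⟩
    rw [gen_neg_natCast]
    simpa using symbol_p_pow (K := K) n

theorem symbol_aeval (f : K[X]) : symbol K (aeval (p K * q K) f) = mono 0 f := by
  induction f using Polynomial.induction_on' with
  | add f g hf hg =>
    refine ext_cf fun r => ?_
    rw [map_add, map_add, hf, hg, map_add, cf_mono, cf_mono, cf_mono]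
    split_ifs <;> simp
  | monomial n c =>
    have h1 : symbol K (p K * q K) = mono 0 X := by
      rw [map_mul, symbol_p, symbol_q, mono_mul_mono]
      simp
    have h2 : ∀ n : ℕ, (mono 0 X : ShiftLaurent K) ^ n = mono 0 (X ^ n) := by
      intro n
      induction n with
      | zero => simp [one_eq_mono]
      | succ n ih => rw [pow_succ, ih, mono_mul_mono]; simp [pow_succ]
    rw [aeval_monomial, ← Algebra.smul_def, map_smul, map_pow, h1, h2, smul_mono,
      smul_X_eq_monomial]

/-- The sum of the homogeneous elements `f_t(p q) · gen t`. -/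
noncomputable def ofCoeffs (K : Type*) [Field K] : (ℤ →₀ K[X]) →ₗ[K] FirstWeylAlgebra K :=
  Finsupp.lsum K fun t =>
    LinearMap.mulRight K (gen K t) ∘ₗ (aeval (p K * q K) : K[X] →ₐ[K] _).toLinearMap

theorem ofCoeffs_single (t : ℤ) (f : K[X]) :
    ofCoeffs K (Finsupp.single t f) = aeval (p K * q K) f * gen K t := by
  simp [ofCoeffs]

theorem ofCoeffs_apply (f : ℤ →₀ K[X]) :
    ofCoeffs K f = ∑ t ∈ f.support, aeval (p K * q K) (f t) * gen K t := by
  simp [ofCoeffs, Finsupp.sum]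

/-- The coefficient of `x ^ t` in `symbol (ofCoeffs f)` is `f t` times a fixed polynomial. -/
theorem cf_symbol_ofCoeffs (t : ℤ) : ∃ g : K[X], g ≠ 0 ∧ g.natDegree = (-t).toNat ∧
    ∀ f : ℤ →₀ K[X], cf t (symbol K (ofCoeffs K f)) = f t * g := by
  classical
  obtain ⟨g, hg0, hgn, hg⟩ := symbol_gen (K := K) t
  refine ⟨g, hg0, hgn, fun f => ?_⟩
  induction f using Finsupp.induction_linear with
  | zero => simp
  | add f₁ f₂ h₁ h₂ => rw [map_add, map_add, map_add, h₁, h₂, Finsupp.add_apply, add_mul]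
  | single r f =>
    rw [ofCoeffs_single, map_mul, symbol_aeval, Finsupp.single_apply]
    split_ifs with h
    · subst h
      rw [hg, mono_mul_mono, zero_add, cf_mono_self]
      simp
    · obtain ⟨g', -, -, hg'⟩ := symbol_gen (K := K) r
      rw [hg', mono_mul_mono, zero_add, cf_mono, if_neg h, zero_mul]

theorem p_mul_aeval (f : K[X]) :
    p K * aeval (p K * q K) f = aeval (p K * q K) (f.comp (X + 1)) * p K := by
  induction f using Polynomial.induction_on' with
  | add f g hf hg => rw [map_add, mul_add, hf, hg, add_comp, map_add, add_mul]
  | monomial n c =>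
    have h1 : p K * (p K * q K) = (p K * q K + 1) * p K := by
      rw [add_mul, one_mul, mul_assoc, p_mul_q, mul_add, mul_one]
    have h2 : SemiconjBy (p K) (p K * q K) (p K * q K + 1) := h1
    rw [aeval_monomial, monomial_comp, map_mul, aeval_C, map_pow, map_add, aeval_X, map_one,
      mul_assoc, ← (h2.pow_right n).eq, ← mul_assoc, ← mul_assoc, Algebra.commutes]

theorem q_mul_aeval (f : K[X]) :
    q K * aeval (p K * q K) f = aeval (p K * q K) (f.comp (X - 1)) * q K := by
  induction f using Polynomial.induction_on' with
  | add f g hf hg => rw [map_add, mul_add, hf, hg, add_comp, map_add, add_mul]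
  | monomial n c =>
    have h1 : q K * (p K * q K) = (p K * q K - 1) * q K := by
      rw [← eq_sub_of_add_eq p_mul_q.symm, mul_assoc]
    have h2 : SemiconjBy (q K) (p K * q K) (p K * q K - 1) := h1
    rw [aeval_monomial, monomial_comp, map_mul, aeval_C, map_pow, map_sub, aeval_X, map_one,
      mul_assoc, ← (h2.pow_right n).eq, ← mul_assoc, ← mul_assoc, Algebra.commutes]

theorem p_mul_gen (t : ℤ) : ∃ f : K[X], p K * gen K t = aeval (p K * q K) f * gen K (t - 1) := by
  rcases le_or_gt t 0 with h | h
  · obtain ⟨n, rfl⟩ : ∃ n : ℕ, t = -n := ⟨(-t).toNat, by omega⟩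
    refine ⟨1, ?_⟩
    rw [show (-(n : ℤ) - 1) = -((n + 1 : ℕ) : ℤ) by push_cast; ring, gen_neg_natCast,
      gen_neg_natCast, pow_succ', map_one, one_mul]
  · obtain ⟨n, rfl⟩ : ∃ n : ℕ, t = (n + 1 : ℕ) := ⟨(t - 1).toNat, by omega⟩
    refine ⟨X, ?_⟩
    rw [show (((n + 1 : ℕ) : ℤ) - 1) = n by push_cast; ring, gen_natCast, gen_natCast, aeval_X,
      pow_succ', mul_assoc]

theorem q_mul_gen (t : ℤ) : ∃ f : K[X], q K * gen K t = aeval (p K * q K) f * gen K (t + 1) := by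
  rcases le_or_gt 0 t with h | h
  · lift t to ℕ using h
    refine ⟨1, ?_⟩
    rw [show ((t : ℤ) + 1) = (t + 1 : ℕ) by push_cast; ring, gen_natCast,
      gen_natCast, pow_succ', map_one, one_mul]
  · obtain ⟨n, rfl⟩ : ∃ n : ℕ, t = -(n + 1 : ℕ) := ⟨(-t - 1).toNat, by omega⟩
    -- Here `qp = pq - 1` absorbs one factor `p`.
    refine ⟨X - 1, ?_⟩
    rw [show (-((n + 1 : ℕ) : ℤ) + 1) = -n by push_cast; ring, gen_neg_natCast, gen_neg_natCast,
      map_sub, aeval_X, map_one, p_mul_q, add_sub_cancel_right, pow_succ', mul_assoc]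

theorem p_mul_ofCoeffs_single (t : ℤ) (f : K[X]) : ∃ g : K[X],
    p K * ofCoeffs K (Finsupp.single t f) = ofCoeffs K (Finsupp.single (t - 1) g) := by
  obtain ⟨g, hg⟩ := p_mul_gen (K := K) t
  refine ⟨f.comp (X + 1) * g, ?_⟩
  rw [ofCoeffs_single, ofCoeffs_single, ← mul_assoc, p_mul_aeval, mul_assoc, hg, map_mul,
    mul_assoc]

theorem q_mul_ofCoeffs_single (t : ℤ) (f : K[X]) : ∃ g : K[X],
    q K * ofCoeffs K (Finsupp.single t f) = ofCoeffs K (Finsupp.single (t + 1) g) := by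
  obtain ⟨g, hg⟩ := q_mul_gen (K := K) t
  refine ⟨f.comp (X - 1) * g, ?_⟩
  rw [ofCoeffs_single, ofCoeffs_single, ← mul_assoc, q_mul_aeval, mul_assoc, hg, map_mul,
    mul_assoc]

/-- The range is stable under left multiplication by `p` and `q`, hence is a left ideal, and it
contains `1`. -/
theorem ofCoeffs_surjective : Function.Surjective (ofCoeffs K) := by
  have hmul : ∀ x : FirstWeylAlgebra K,
      (∀ t f, x * ofCoeffs K (Finsupp.single t f) ∈ LinearMap.range (ofCoeffs K)) →
      ∀ y ∈ LinearMap.range (ofCoeffs K), x * y ∈ LinearMap.range (ofCoeffs K) := by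
    rintro x hx _ ⟨f, rfl⟩
    induction f using Finsupp.induction_linear with
    | zero => simp
    | add f₁ f₂ h₁ h₂ =>
      rw [map_add, mul_add]
      exact Submodule.add_mem _ h₁ h₂
    | single t f => exact hx t f
  have hp := hmul (p K) fun t f => by
    obtain ⟨g, hg⟩ := p_mul_ofCoeffs_single t f
    exact ⟨_, hg.symm⟩
  have hq := hmul (q K) fun t f => by
    obtain ⟨g, hg⟩ := q_mul_ofCoeffs_single t f
    exact ⟨_, hg.symm⟩
  have hall : ∀ x ∈ Algebra.adjoin K {p K, q K},
      ∀ y ∈ LinearMap.range (ofCoeffs K), x * y ∈ LinearMap.range (ofCoeffs K) := by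
    intro x hx
    induction hx using Algebra.adjoin_induction with
    | mem x hx =>
      rcases hx with rfl | rfl
      · exact hp
      · exact hq
    | algebraMap c =>
      intro y hy
      rw [← Algebra.smul_def]
      exact Submodule.smul_mem _ _ hy
    | add x y _ _ hx hy =>
      intro z hz
      rw [add_mul]
      exact Submodule.add_mem _ (hx z hz) (hy z hz)
    | mul x y _ _ hx hy =>
      intro z hz
      rw [mul_assoc]
      exact hx _ (hy z hz)
  intro x
  have := hall x (by rw [adjoin_p_q]; trivial) 1
    ⟨Finsupp.single 0 1, by rw [ofCoeffs_single]; simp [gen]⟩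
  rwa [mul_one] at this

/-- In the normal form `∑ f_t(pq) · gen t`, the symbol multiplies each `f_t` by a nonzero
polynomial, so every `f_t` can be recovered. -/
theorem symbol_injective : Function.Injective (symbol K) := by
  rw [injective_iff_map_eq_zero]
  intro x hx
  obtain ⟨f, rfl⟩ := ofCoeffs_surjective x
  have : f = 0 := by
    ext1 t
    obtain ⟨g, hg0, -, hg⟩ := cf_symbol_ofCoeffs (K := K) t
    have h := hg f
    rw [hx, map_zero] at h
    exact (mul_eq_zero.1 h.symm).resolve_right hg0
  rw [this, map_zero]

/-- Coefficients at negative exponents are divisible by the rising factorial coming from a power of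
`p`. This bound is what later forces `s = 1`. -/
theorem natDegree_cf_symbol (x : FirstWeylAlgebra K) {t : ℤ} (h : cf t (symbol K x) ≠ 0) :
    (-t).toNat ≤ (cf t (symbol K x)).natDegree := by
  obtain ⟨f, rfl⟩ := ofCoeffs_surjective x
  obtain ⟨g, hg0, hgn, hg⟩ := cf_symbol_ofCoeffs (K := K) t
  rw [hg] at h ⊢
  rw [natDegree_mul (left_ne_zero_of_mul h) hg0]
  omega

/-- The homogeneous components of an element of the Weyl algebra. -/
theorem exists_component (x : FirstWeylAlgebra K) (t : ℤ) :
    ∃ y, symbol K y = mono t (cf t (symbol K x)) := by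
  classical
  obtain ⟨f, rfl⟩ := ofCoeffs_surjective x
  refine ⟨ofCoeffs K (Finsupp.single t (f t)), ext_cf fun r => ?_⟩
  obtain ⟨g, -, -, hg⟩ := cf_symbol_ofCoeffs (K := K) r
  rw [hg, cf_mono, Finsupp.single_apply]
  split_ifs with h
  · subst h
    rw [hg]
  · rw [zero_mul]

theorem cf_symbol_of_mem_homogeneous {x : FirstWeylAlgebra K} {t r : ℤ}
    (hx : x ∈ homogeneous K t) (hr : r ≠ t) : cf r (symbol K x) = 0 := by
  induction hx using Submodule.span_induction with
  | mem x hx =>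
    obtain ⟨i, j, hij, rfl⟩ := hx
    obtain ⟨g, -, -, hg⟩ := symbol_p_pow (K := K) i
    rw [map_mul, hg, symbol_q_pow, mono_mul_mono, cf_mono, if_neg (by omega)]
  | zero => simp
  | add x y _ _ hx hy => rw [map_add, map_add, hx, hy, add_zero]
  | smul c x _ hx => rw [map_smul, map_smul, hx, smul_zero]

theorem cf_symbol_of_mem_homogeneousGT {x : FirstWeylAlgebra K} {i r : ℤ}
    (hx : x ∈ homogeneousGT K i) (hr : r ≤ i) : cf r (symbol K x) = 0 := by
  have hle : homogeneousGT K i ≤ LinearMap.ker (cf r ∘ₗ (symbol K).toLinearMap) :=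
    iSup₂_le fun t ht y hy => cf_symbol_of_mem_homogeneous hy (by omega)
  exact hle hx

end FirstWeylAlgebra

/-! ### Reduction modulo `K[z]` and the resulting canonical pair -/

namespace FirstWeylAlgebra

open ShiftLaurent

variable {K : Type*} [Field K]

theorem mem_centralizer_of_shiftComm_eq_zero {x y : FirstWeylAlgebra K} {a b : ℤ} {f g : K[X]}
    (hx : symbol K x = mono a f) (hy : symbol K y = mono b g) (h : shiftComm f g a b = 0) :
    y ∈ Subalgebra.centralizer K {x} := by
  rw [Subalgebra.mem_centralizer_iff]
  intro t ht
  rw [Set.mem_singleton_iff.1 ht]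
  apply symbol_injective
  rw [map_mul, map_mul, hx, hy, mono_mul_mono, mono_mul_mono, add_comm b, sub_eq_zero.1 h]

/-- A homogeneous polynomial expression in a homogeneous element is a monomial in it. -/
theorem exists_eq_smul_pow_of_mem_adjoin {x y : FirstWeylAlgebra K} {a r : ℤ} {f g : K[X]}
    (ha : a ≠ 0) (hx : symbol K x = mono a f) (hy : symbol K y = mono r g) (hg : g ≠ 0)
    (hmem : y ∈ Algebra.adjoin K {x}) :
    ∃ (k : ℕ) (c : K), r = k * a ∧ g = c • cf r (symbol K x ^ k) := by
  rw [Algebra.adjoin_singleton_eq_range_aeval, AlgHom.mem_range] at hmem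
  obtain ⟨P, hP⟩ := hmem
  have hpow : ∀ k : ℕ, r ≠ k * a → cf r (symbol K x ^ k) = 0 := by
    intro k hk
    obtain ⟨g', hg'⟩ := mono_pow a f k
    rw [hx, hg', cf_mono, if_neg (Ne.symm hk)]
  have hsum : g = ∑ k ∈ P.support, P.coeff k • cf r (symbol K x ^ k) := by
    rw [← cf_mono_self r g, ← hy, ← hP, aeval_eq_sum_range, map_sum, map_sum]
    refine (Finset.sum_subset supp_subset_range_natDegree_succ fun k _ hk => ?_).symm.trans
      (Finset.sum_congr rfl fun k _ => ?_)
    · rw [notMem_support_iff.1 hk, zero_smul, map_zero, map_zero]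
    · rw [map_smul, map_smul, map_pow]
  obtain ⟨k, hk, hk0⟩ := Finset.exists_ne_zero_of_sum_ne_zero (fun h => hg (hsum.trans h))
  have hrk : r = k * a := by
    by_contra hne
    exact hk0 (by rw [hpow k hne, smul_zero])
  -- Since `a ≠ 0`, the exponents `k * a` are distinct, so only one power contributes in degree `r`.
  refine ⟨k, P.coeff k, hrk, hsum.trans (Finset.sum_eq_single k (fun j _ hjk => ?_)
    (fun h => absurd hk h))⟩
  rw [hpow j, smul_zero]
  rw [hrk]
  intro h
  exact hjk (by exact_mod_cast (mul_right_cancel₀ ha h).symm)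

/-- An element whose lowest component commutes with that of `z` can be improved modulo `K[z]`,
when the centralizer of the lowest component `zs` of `z` is `K[zs]`. -/
theorem exists_sub_mem_adjoin_lowerBound {z zs w : FirstWeylAlgebra K} {s r : ℤ} (hs : 0 < s)
    (hzlow : LowerBound (-s) (symbol K z)) (hzs : symbol K zs = mono (-s) (cf (-s) (symbol K z)))
    (hC : Subalgebra.centralizer K {zs} = Algebra.adjoin K {zs})
    (hw : LowerBound r (symbol K w))
    (hcomm : shiftComm (cf (-s) (symbol K z)) (cf r (symbol K w)) (-s) r = 0) :
    ∃ u ∈ Algebra.adjoin K {z}, LowerBound (r + 1) (symbol K (w - u)) := by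
  have hstep : ∀ u, LowerBound r (symbol K u) → cf r (symbol K u) = cf r (symbol K w) →
      LowerBound (r + 1) (symbol K (w - u)) := by
    intro u hu hur t ht
    rw [map_sub, map_sub]
    rcases eq_or_lt_of_le (Int.lt_add_one_iff.1 ht) with rfl | h
    · rw [hur, sub_self]
    · rw [hw t h, hu t h, sub_self]
  by_cases hc : cf r (symbol K w) = 0
  · exact ⟨0, Subalgebra.zero_mem _, hstep 0 (fun t _ => by simp) (by simp [hc])⟩
  obtain ⟨y, hy⟩ := exists_component w r
  have hmem : y ∈ Algebra.adjoin K {zs} :=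
    hC ▸ mem_centralizer_of_shiftComm_eq_zero hzs hy hcomm
  obtain ⟨k, c, hrk, hck⟩ :=
    exists_eq_smul_pow_of_mem_adjoin (neg_ne_zero.2 hs.ne') hzs hy hc hmem
  have hzslow : LowerBound (-s) (symbol K zs) := by
    intro t ht
    rw [hzs, cf_mono, if_neg (by omega)]
  have hpow : cf r (symbol K z ^ k) = cf r (symbol K zs ^ k) := by
    rw [hrk]
    exact hzlow.cf_pow_congr hzslow (by rw [hzs, cf_mono_self]) k
  have hz_mem : z ∈ Algebra.adjoin K {z} := Algebra.subset_adjoin rfl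
  refine ⟨c • z ^ k, Subalgebra.smul_mem _ (Subalgebra.pow_mem _ hz_mem k) _, hstep _ ?_ ?_⟩
  · intro t ht
    rw [map_smul, map_smul, map_pow, hzlow.pow k t (hrk ▸ ht), smul_zero]
  · rw [map_smul, map_smul, map_pow, hpow, hck]

theorem commutator_sub_of_mem_adjoin {z w u : FirstWeylAlgebra K} (h : z * w - w * z = 1)
    (hu : u ∈ Algebra.adjoin K {z}) : z * (w - u) - (w - u) * z = 1 := by
  have hzu : z * u = u * z := by
    have := Algebra.adjoin_le_centralizer_centralizer K {z} hu
    rw [Subalgebra.mem_centralizer_iff] at this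
    refine this z ?_
    rw [Subalgebra.coe_centralizer]
    simp [Set.mem_centralizer_iff]
  rw [mul_sub, sub_mul, hzu, ← h]
  abel

/-- Below exponent `s`, the lowest component of `w` meets that of `z` in negative degree, where `1`
vanishes, so they commute and the order of `w` can be raised. `N` bounds the number of corrections
needed. -/
theorem exists_lowerBound_of_commutator_eq_one {z zs : FirstWeylAlgebra K} {s : ℤ} (hs : 0 < s)
    (hzlow : LowerBound (-s) (symbol K z)) (hzs : symbol K zs = mono (-s) (cf (-s) (symbol K z)))
    (hC : Subalgebra.centralizer K {zs} = Algebra.adjoin K {zs}) (N : ℕ) :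
    ∀ w : FirstWeylAlgebra K, z * w - w * z = 1 → LowerBound (s - N) (symbol K w) →
      ∃ u ∈ Algebra.adjoin K {z}, LowerBound s (symbol K (w - u)) := by
  induction N with
  | zero =>
    intro w _ hw
    exact ⟨0, Subalgebra.zero_mem _, by simpa using hw⟩
  | succ N ih =>
    intro w hzw hw
    have hcomm : shiftComm (cf (-s) (symbol K z)) (cf (s - (N + 1 : ℕ)) (symbol K w)) (-s)
        (s - (N + 1 : ℕ)) = 0 := by
      rw [← hzlow.cf_commutator hw, ← map_mul, ← map_mul, ← map_sub, hzw, map_one, one_eq_mono,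
        cf_mono, if_neg (by push_cast; omega)]
    obtain ⟨u, hu, hlow⟩ := exists_sub_mem_adjoin_lowerBound hs hzlow hzs hC hw hcomm
    obtain ⟨v, hv, hvlow⟩ := ih (w - u) (commutator_sub_of_mem_adjoin hzw hu)
      (by convert hlow using 1; push_cast; ring)
    exact ⟨u + v, Subalgebra.add_mem _ hu hv, by rwa [← sub_sub]⟩

/-- The lowest components of a canonical pair in degrees `-s` and `s` are those of `p` and `q`. -/
theorem lowest_of_commutator_eq_one [CharZero K] {z w : FirstWeylAlgebra K} {s : ℤ} (hs : 0 < s)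
    (hz : LowerBound (-s) (symbol K z)) (hw : LowerBound s (symbol K w))
    (hzw : z * w - w * z = 1) :
    s = 1 ∧ (cf (-s) (symbol K z)).natDegree = 1 ∧ cf s (symbol K w) ≠ 0 ∧
      (cf s (symbol K w)).natDegree = 0 := by
  have hone : shiftComm (cf (-s) (symbol K z)) (cf s (symbol K w)) (-s) s
      = cf 0 (1 : ShiftLaurent K) := by
    rw [← hz.cf_commutator hw, ← map_mul, ← map_mul, ← map_sub, hzw, map_one, neg_add_cancel]
  have hne : cf 0 (1 : ShiftLaurent K) ≠ 0 := by
    rw [one_eq_mono, cf_mono_self]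
    exact one_ne_zero
  have hz0 : cf (-s) (symbol K z) ≠ 0 := by
    intro h
    rw [h, shiftComm_zero_left] at hone
    exact hne hone.symm
  have hw0 : cf s (symbol K w) ≠ 0 := by
    intro h
    rw [h, shiftComm_zero_right] at hone
    exact hne hone.symm
  have hdeg := natDegree_cf_symbol z hz0
  set d := (cf (-s) (symbol K z)).natDegree with hd
  set e := (cf s (symbol K w)).natDegree with he
  rw [neg_neg] at hdeg
  have hcoeff := coeff_shiftComm (-s) s (hd ▸ le_rfl : (cf (-s) (symbol K z)).natDegree ≤ d)
    (he ▸ le_rfl : (cf s (symbol K w)).natDegree ≤ e) (k := d + e - 1) (by omega)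
  rw [if_pos (by omega), hone] at hcoeff
  have hcoeff0 : (cf 0 (1 : ShiftLaurent K)).coeff (d + e - 1) ≠ 0 := by
    rw [hcoeff]
    refine mul_ne_zero (mul_ne_zero ?_ (leadingCoeff_ne_zero.2 hz0)) (leadingCoeff_ne_zero.2 hw0)
    -- The determinant for exponents `-s` and `s` is `(d + e)s`, nonzero in characteristic zero.
    have h1 : ((d + e : ℕ) : ℤ) * s ≠ 0 := mul_ne_zero (by omega) hs.ne'
    have h2 : ((((d + e : ℕ) : ℤ) * s : ℤ) : K) ≠ 0 := by exact_mod_cast h1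
    convert h2 using 1
    push_cast
    ring
  obtain ⟨-, h⟩ := coeff_cf_one hcoeff0
  -- The degree `d + e - 1` must be `0`, while `d ≥ s ≥ 1`; hence `d = s = 1` and `e = 0`.
  exact ⟨by omega, by omega, hw0, by omega⟩

/-- Here `w` is a nonzero multiple of `q`. The coefficient of `z` at `-1` has degree one, already
used up by `p`, so `z` is a nonzero multiple of `p` plus a polynomial in `q`. -/
theorem adjoin_eq_top_of_triangular {z w : FirstWeylAlgebra K}
    (hz : LowerBound (-1) (symbol K z)) (hz1 : (cf (-1) (symbol K z)).natDegree = 1)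
    (hzt : ∀ t ≠ -1, (cf t (symbol K z)).natDegree = 0)
    (hw1 : cf 1 (symbol K w) ≠ 0) (hw1d : (cf 1 (symbol K w)).natDegree = 0)
    (hwt : ∀ t ≠ 1, cf t (symbol K w) = 0) :
    Algebra.adjoin K {z, w} = ⊤ := by
  classical
  set A := Algebra.adjoin K {z, w} with hA
  have hzA : z ∈ A := Algebra.subset_adjoin (by simp)
  have hwA : w ∈ A := Algebra.subset_adjoin (by simp)
  have hq : q K ∈ A := by
    obtain ⟨c, hc⟩ : ∃ c, cf 1 (symbol K w) = C c := ⟨_, eq_C_of_natDegree_eq_zero hw1d⟩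
    have hc0 : c ≠ 0 := by
      rintro rfl
      exact hw1 (by rw [hc, C_0])
    have hwq : w = c • q K := by
      refine symbol_injective (ext_cf fun t => ?_)
      rw [map_smul, symbol_q, smul_mono, cf_mono]
      split_ifs with h
      · subst h
        rw [hc, smul_eq_C_mul, mul_one]
      · exact hwt t (Ne.symm h)
    rw [← inv_smul_smul₀ hc0 (q K), ← hwq]
    exact Subalgebra.smul_mem _ hwA _
  have hp : p K ∈ A := by
    obtain ⟨f, rfl⟩ := ofCoeffs_surjective z
    obtain ⟨g, hg0, hgn, hg⟩ := cf_symbol_ofCoeffs (K := K) (-1)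
    have hf0 : f (-1) ≠ 0 := by
      intro h
      rw [hg, h, zero_mul, natDegree_zero] at hz1
      exact zero_ne_one hz1
    have hfd : (f (-1)).natDegree = 0 := by
      rw [hg, natDegree_mul hf0 hg0, hgn] at hz1
      simpa using hz1
    obtain ⟨c, hc⟩ : ∃ c, f (-1) = C c := ⟨_, eq_C_of_natDegree_eq_zero hfd⟩
    have hc0 : c ≠ 0 := by
      rintro rfl
      exact hf0 (by rw [hc, C_0])
    have hrest : ∑ t ∈ f.support.erase (-1), aeval (p K * q K) (f t) * gen K t ∈ A := by
      refine Subalgebra.sum_mem _ fun t ht => ?_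
      rw [Finset.mem_erase, Finsupp.mem_support_iff] at ht
      obtain ⟨g, hg0, hgn, hg⟩ := cf_symbol_ofCoeffs (K := K) t
      have ht0 : -1 ≤ t := by
        by_contra hlt
        have := hz t (not_le.1 hlt)
        rw [hg] at this
        exact mul_ne_zero ht.2 hg0 this
      have hd := hzt t ht.1
      rw [hg, natDegree_mul ht.2 hg0] at hd
      obtain ⟨b, hb⟩ : ∃ b, f t = C b := ⟨_, eq_C_of_natDegree_eq_zero (by omega)⟩
      lift t to ℕ using by have := ht.1; omega
      rw [hb, aeval_C, ← Algebra.smul_def, gen_natCast]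
      exact Subalgebra.smul_mem _ (Subalgebra.pow_mem _ hq _) _
    have hmem : -1 ∈ f.support := Finsupp.mem_support_iff.2 hf0
    have hsplit := ofCoeffs_apply f
    rw [← Finset.add_sum_erase _ _ hmem, hc, aeval_C, ← Algebra.smul_def,
      show gen K (-1) = p K by simpa using gen_neg_natCast (K := K) 1] at hsplit
    rw [← inv_smul_smul₀ hc0 (p K), eq_sub_of_add_eq hsplit.symm]
    exact Subalgebra.smul_mem _ (Subalgebra.sub_mem _ hzA hrest) _
  rw [eq_top_iff, ← adjoin_p_q]
  refine Algebra.adjoin_le ?_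
  rintro x (rfl | rfl)
  · exact hp
  · exact hq

end FirstWeylAlgebra

/-! ### Conclusion -/

open FirstWeylAlgebra ShiftLaurent in
theorem mainTheorem3 {K : Type*} [Field K] [CharZero K]
    (z w zs z' : FirstWeylAlgebra K) (s : ℤ) (hs : 0 < s)
    (hzw : z * w - w * z = 1)
    (hz : z = zs + z')
    (hzs : zs ∈ FirstWeylAlgebra.homogeneous K (-s))
    (hzs_ne : zs ≠ 0)
    (hz' : z' ∈ FirstWeylAlgebra.homogeneousGT K (-s))
    (hC : Subalgebra.centralizer K {zs} = Algebra.adjoin K {zs}) :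
    Algebra.adjoin K {z, w} = ⊤ := by
  have hzlow : LowerBound (-s) (symbol K z) := by
    intro t ht
    rw [hz, map_add, map_add, cf_symbol_of_mem_homogeneous hzs ht.ne,
      cf_symbol_of_mem_homogeneousGT hz' ht.le, add_zero]
  have hzsm : symbol K zs = mono (-s) (cf (-s) (symbol K z)) := by
    refine ext_cf fun t => ?_
    rw [cf_mono]
    split_ifs with h
    · subst h
      rw [hz, map_add, map_add, cf_symbol_of_mem_homogeneousGT hz' le_rfl, add_zero]
    · exact cf_symbol_of_mem_homogeneous hzs (Ne.symm h)
  obtain ⟨N, hN⟩ : ∃ N : ℕ, LowerBound (s - N) (symbol K w) := by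
    obtain ⟨m, hm⟩ := (supp (symbol K w)).bddBelow
    refine ⟨(s - m).toNat, fun t ht => ?_⟩
    by_contra h
    have := hm (mem_supp.2 h)
    omega
  obtain ⟨u, hu, hlow⟩ := exists_lowerBound_of_commutator_eq_one hs hzlow hzsm hC N w hzw hN
  have hzv := commutator_sub_of_mem_adjoin hzw hu
  obtain ⟨rfl, hd1, hv0, hd0⟩ := lowest_of_commutator_eq_one hs hzlow hlow hzv
  obtain ⟨h1, h2⟩ := triangular_of_commutator_eq_one
    (by rw [← map_mul, ← map_mul, ← map_sub, hzv, map_one]) hzlow hlow hd1 hv0 hd0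
  have htop := adjoin_eq_top_of_triangular hzlow hd1 h1 hv0 hd0 h2
  -- Since `u` lies in `K[z]`, the corrected pair `z`, `w - u` lies in the algebra generated by `z`
  -- and `w`.
  rw [eq_top_iff, ← htop]
  refine Algebra.adjoin_le ?_
  have hz_mem : z ∈ Algebra.adjoin K {z, w} := Algebra.subset_adjoin (by simp)
  rintro x (rfl | rfl)
  · exact hz_mem
  · exact Subalgebra.sub_mem _ (Algebra.subset_adjoin (by simp))
      (Algebra.adjoin_mono (by simp) hu)
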